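/- Let $r \ge 0$, let $F$ be the free group on $x_1,\dots,x_r$, let $N$ be a normal subgroup of $F$, $N'=[N,N]$ its commutator subgroup and $B=F/N$, with $g\mapsto \bar g$ the projection $F\to B$. Let $A=\mathbb{Z}^r$, written multiplicatively with standard basis $a_1,\dots,a_r$, and let $A\wr B$ be the restricted wreath product: the set of pairs $(f,b)$ with $b\in B$ and $f:B\to A$ of finite support, with product $(f,b)(f',b')=\big(x\mapsto f(x)f'(b^{-1}x),\,bb'\big)$. Identify $A$ with the pairs $(f,1)$ with $f$ supported at $1_B$, and $B$ with the pairs $(1,b)$. For $g\in F$ let $\partial g/\partial x_i\in\mathbb{Z}[F]$ be the Fox derivatives, determined by $\partial x_j/\partial x_i=\delta_{ij}$ and $\partial(gh)/\partial x_i=\partial g/\partial x_i+g\,\partial h/\partial x_i$, and let $\overline{\partial g/\partial x_i}$ be their images in $\mathbb{Z}[B]$. The Magnus embedding is the homomorphism $\phi:F/N'\to A\wr B$ which sends the class of $g\in F$ to $(f_g,\bar g)$, where $f_g(b)=\prod_{i=1}^r a_i^{u_i(b)}$ and $u_i(b)$ is the coefficient of $b$ in $\overline{\partial g/\partial x_i}$;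 thus $\phi(x_i)=a_i\bar x_i$. For $w\in F/N'$ let $\|w\|_{F/N'}$ be the word length of $w$ with respect to the images of $x_1,\dots,x_r$, and for $v\in A\wr B$ let $\|v\|_{A\wr B}$ be the word length of $v$ with respect to $a_1,\dots,a_r,\bar x_1,\dots,\bar x_r$ (letters and their inverses are allowed in words). Then for every $w\in F/N'$ $$\frac{1}{2(r+1)}\,\|w\|_{F/N'}\;\le\;\|\phi(w)\|_{A\wr B}\;\le\;3\,\|w\|_{F/N'} .$$ Consequently, $\phi$ is a bi-Lipschitz (in particular quasi-isometric) embedding for the word metrics $d(g,h)=\|g^{-1}h\|$: it is injective and for all $u,v\in F/N'$ $$\frac{1}{2(r+1)}\,d_{F/N'}(u,v)\;\le\; d_{A\wr B}(\phi(u),\phi(v))\;\le\;3\,d_{F/N'}(u,v).$$ -/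

import Mathlib

noncomputable section

namespace MagnusEmbedding

/-! ### Word metrics -/

/-- The word norm of `g` with respect to `S`: the least length of a word in the letters `s` and
`s⁻¹`, `s ∈ S`, whose value in `G` is `g`. (It is only used for generating sets `S`.) -/
def wordNorm {G : Type*} [Group G] (S : Set G) (g : G) : ℕ :=
  sInf {n : ℕ | ∃ l : List G, (∀ y ∈ l, y ∈ S ∨ y⁻¹ ∈ S) ∧ l.prod = g ∧ l.length = n}

/-- The (left invariant) word metric: the distance from `g` to `h` in the Cayley graph whose edges
join `g` to `g * s`, `s ∈ S`. -/
def wordDist {G : Type*} [Group G] (S : Set G) (g h : G) : ℕ :=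
  wordNorm S (g⁻¹ * h)

/-! ### Fox derivatives -/

/-- The Fox derivative with respect to `x_i`, computed letter by letter on a word
(`(j, true)` is the letter `x_j` and `(j, false)` is the letter `x_j⁻¹`). -/
def foxWord {r : ℕ} (i : Fin r) : List (Fin r × Bool) → MonoidAlgebra ℤ (FreeGroup (Fin r))
  | [] => 0
  | (j, true) :: L =>
      (if j = i then 1 else 0) + MonoidAlgebra.single (FreeGroup.of j) 1 * foxWord i L
  | (j, false) :: L =>
      (if j = i then -MonoidAlgebra.single (FreeGroup.of j)⁻¹ 1 else 0)
        + MonoidAlgebra.single (FreeGroup.of j)⁻¹ 1 * foxWord i L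

/-- The Fox derivative `∂g/∂x_i` in the integral group ring of the free group; by `foxDeriv_of`
and `foxDeriv_mul` it is the derivation with `∂x_j/∂x_i = δ_ij` and
`∂(gh)/∂x_i = ∂g/∂x_i + g ∂h/∂x_i`. -/
def foxDeriv {r : ℕ} (i : Fin r) (g : FreeGroup (Fin r)) : MonoidAlgebra ℤ (FreeGroup (Fin r)) :=
  foxWord i g.toWord

theorem foxWord_append {r : ℕ} (i : Fin r) (L M : List (Fin r × Bool)) :
    foxWord i (L ++ M) = foxWord i L + MonoidAlgebra.single (FreeGroup.mk L) 1 * foxWord i M := by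
  induction L with
  | nil => simp [foxWord, ← FreeGroup.one_eq_mk, ← MonoidAlgebra.one_def]
  | cons p L ih =>
    obtain ⟨j, b⟩ := p
    have h : ∀ b, FreeGroup.mk ((j, b) :: L) = FreeGroup.mk [(j, b)] * FreeGroup.mk L := by
      intro b; rw [FreeGroup.mul_mk]; rfl
    have h1 : FreeGroup.mk [(j, false)] = (FreeGroup.of j)⁻¹ := rfl
    have h2 : FreeGroup.mk [(j, true)] = FreeGroup.of j := rfl
    cases b <;>
      simp only [List.cons_append, foxWord, ih, h, h1, h2, mul_add, ← mul_assoc, add_assoc,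
        MonoidAlgebra.single_mul_single, mul_one]

theorem foxWord_step {r : ℕ} (i : Fin r) {L M : List (Fin r × Bool)}
    (h : FreeGroup.Red.Step L M) : foxWord i L = foxWord i M := by
  cases h with
  | @not L₁ L₂ j b =>
    rw [foxWord_append, foxWord_append]
    congr 2
    cases b <;> by_cases hj : j = i <;>
      simp [foxWord, hj, mul_add, ← mul_assoc, MonoidAlgebra.single_mul_single,
        ← MonoidAlgebra.one_def]

theorem foxDeriv_mk {r : ℕ} (i : Fin r) (L : List (Fin r × Bool)) :
    foxDeriv i (FreeGroup.mk L) = foxWord i L := by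
  have h : ∀ M, FreeGroup.Red L M → foxWord i M = foxWord i L := by
    intro M hM
    induction hM with
    | refl => rfl
    | tail _ hs ih => rw [← foxWord_step i hs, ih]
  exact h _ (by rw [FreeGroup.toWord_mk]; exact FreeGroup.reduce.red)

theorem foxDeriv_of {r : ℕ} (i j : Fin r) :
    foxDeriv i (FreeGroup.of j) = if j = i then 1 else 0 := by
  simp [foxDeriv, foxWord]

theorem foxDeriv_mul {r : ℕ} (i : Fin r) (g h : FreeGroup (Fin r)) :
    foxDeriv i (g * h) = foxDeriv i g + MonoidAlgebra.single g 1 * foxDeriv i h := by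
  have e : g * h = FreeGroup.mk (g.toWord ++ h.toWord) := by
    rw [← FreeGroup.mul_mk, FreeGroup.mk_toWord, FreeGroup.mk_toWord]
  rw [e, foxDeriv_mk, foxWord_append, FreeGroup.mk_toWord]
  rfl

/-! ### The (restricted) wreath product -/

/-- The restricted wreath product `A ≀ B`: pairs `(f, b)` of a finitely supported `f : B → A` and
`b : B`, with `(f, b) (f', b') = (f · (x ↦ f' (b⁻¹ x)), b b')`, as a subgroup of the unrestricted
regular wreath product. -/
def Wreath (A B : Type*) [Group A] [Group B] : Subgroup (RegularWreathProduct A B) where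
  carrier := {w | (Function.mulSupport w.left).Finite}
  one_mem' := by simp
  mul_mem' {u v} hu hv := by
    refine (hu.union (hv.image (fun x => u.right * x))).subset ?_
    intro x hx
    simp only [RegularWreathProduct.mul_left, Function.mem_mulSupport, Pi.mul_apply] at hx
    by_cases h : u.left x = 1
    · right
      exact ⟨u.right⁻¹ * x, by simpa [h] using hx, by simp⟩
    · left
      exact h
  inv_mem' {u} hu := by
    refine (hu.image (fun x => u.right⁻¹ * x)).subset ?_
    intro x hx
    simp only [RegularWreathProduct.inv_left, Function.mem_mulSupport, Pi.inv_apply, ne_eq,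
      inv_eq_one] at hx
    exact ⟨u.right * x, hx, by simp⟩

/-- The canonical copy of `A` in `A ≀ B`: the functions supported at `1`. -/
def Wreath.base {A B : Type*} [Group A] [Group B] (a : A) : Wreath A B :=
  open Classical in
  ⟨⟨Pi.mulSingle 1 a, 1⟩, (Set.finite_singleton (1 : B)).subset Pi.mulSupport_mulSingle_subset⟩

theorem Wreath.base_left {A B : Type*} [Group A] [Group B] [DecidableEq B] (a : A) (b : B) :
    (Wreath.base a : Wreath A B).1.left b = if b = 1 then a else 1 := by
  by_cases h : b = 1 <;> simp [Wreath.base, h]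

/-- The canonical copy of `B` in `A ≀ B`. -/
def Wreath.top {A B : Type*} [Group A] [Group B] (b : B) : Wreath A B :=
  ⟨⟨1, b⟩, by simp [Wreath]⟩

/-! ### The Magnus embedding -/

/-- `ℤ^r`, written multiplicatively. -/
abbrev FreeAb (r : ℕ) : Type := Multiplicative (Fin r → ℤ)

/-- The `i`-th standard generator `a_i` of `ℤ^r`. -/
def FreeAb.gen {r : ℕ} (i : Fin r) : FreeAb r := Multiplicative.ofAdd (Pi.single i 1)

variable {r : ℕ} (N : Subgroup (FreeGroup (Fin r))) [N.Normal]

/-- The images of the free generators in `F / N'`, where `N' = ⁅N, N⁆`. -/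
def quotGens : Set (FreeGroup (Fin r) ⧸ ⁅N, N⁆) :=
  Set.range fun i : Fin r => QuotientGroup.mk' ⁅N, N⁆ (FreeGroup.of i)

/-- The standard generators `a_1, …, a_r, x_1, …, x_r` of `ℤ^r ≀ (F / N)`. -/
def wreathGens : Set (Wreath (FreeAb r) (FreeGroup (Fin r) ⧸ N)) :=
  Set.range (fun i : Fin r => Wreath.base (FreeAb.gen i)) ∪
    Set.range (fun i : Fin r => Wreath.top (QuotientGroup.mk' N (FreeGroup.of i)))

/-- The image of the Fox derivative `∂g/∂x_i` in the integral group ring of `F / N`. -/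
def foxBar (i : Fin r) (g : FreeGroup (Fin r)) : MonoidAlgebra ℤ (FreeGroup (Fin r) ⧸ N) :=
  MonoidAlgebra.mapDomainRingHom ℤ (QuotientGroup.mk' N) (foxDeriv i g)

theorem foxBar_mul (i : Fin r) (g h : FreeGroup (Fin r)) (b : FreeGroup (Fin r) ⧸ N) :
    (foxBar N i (g * h)).coeff b =
      (foxBar N i g).coeff b + (foxBar N i h).coeff ((QuotientGroup.mk' N g)⁻¹ * b) := by
  have h1 : foxBar N i (g * h) =
      foxBar N i g + MonoidAlgebra.single (QuotientGroup.mk' N g) 1 * foxBar N i h := by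
    simp only [foxBar, foxDeriv_mul, map_add, map_mul]
    simp
  rw [h1, MonoidAlgebra.coeff_add, Finsupp.add_apply, MonoidAlgebra.coeff_single_mul_apply,
    one_mul]

/-- The homomorphism `F → ℤ^r ≀ (F / N)`,
`g ↦ a_1 ^ (∂g/∂x_1) ⋯ a_r ^ (∂g/∂x_r) · ḡ`: the value at `b` of its function part is
`∏ i, a_i ^ (coefficient of b in the image of ∂g/∂x_i in ℤ[F / N])`. -/
def magnusFree : FreeGroup (Fin r) →* Wreath (FreeAb r) (FreeGroup (Fin r) ⧸ N) :=
  MonoidHom.mk'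
    (fun g => ⟨⟨fun b => ∏ i, FreeAb.gen i ^ (foxBar N i g).coeff b, QuotientGroup.mk' N g⟩, by
      refine (Set.finite_iUnion fun i : Fin r => (foxBar N i g).coeff.hasFiniteSupport).subset ?_
      intro b hb
      by_contra hcon
      simp only [Set.mem_iUnion, Function.mem_support, not_exists, not_not] at hcon
      exact hb (by simp [hcon])⟩)
    (by
      intro g h
      apply Subtype.ext
      apply RegularWreathProduct.ext
      · funext b
        simp only [Subgroup.coe_mul, RegularWreathProduct.mul_left, Pi.mul_apply, foxBar_mul,
          zpow_add, Finset.prod_mul_distrib]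
      · simp)

/-- The Magnus embedding `φ : F / N' → ℤ^r ≀ (F / N)`. -/
def magnus : FreeGroup (Fin r) ⧸ ⁅N, N⁆ →* Wreath (FreeAb r) (FreeGroup (Fin r) ⧸ N) :=
  QuotientGroup.lift ⁅N, N⁆ (magnusFree N) (by
    suffices h : ⁅N, N⁆ ≤ (magnusFree N).ker from fun x hx => h hx
    rw [Subgroup.commutator_le]
    intro g hg h hh
    have key : ∀ x ∈ N, (magnusFree N x).1.right = 1 := fun x hx =>
      (QuotientGroup.eq_one_iff x).2 hx
    rw [MonoidHom.mem_ker, map_commutatorElement, commutatorElement_eq_one_iff_mul_comm]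
    apply Subtype.ext
    apply RegularWreathProduct.ext
    · funext b
      simp only [Subgroup.coe_mul, RegularWreathProduct.mul_left, Pi.mul_apply, key g hg, key h hh,
        inv_one, one_mul]
      exact mul_comm _ _
    · simp [key g hg, key h hh])

/-- The Magnus embedding is the homomorphism with `x_i ↦ a_i x_i`. -/
theorem magnus_of (i : Fin r) :
    magnus N (QuotientGroup.mk' ⁅N, N⁆ (FreeGroup.of i)) =
      Wreath.base (FreeAb.gen i) * Wreath.top (QuotientGroup.mk' N (FreeGroup.of i)) := by
  classical
  apply Subtype.ext
  apply RegularWreathProduct.ext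
  · funext b
    change ∏ j, FreeAb.gen j ^ (foxBar N j (FreeGroup.of i)).coeff b =
      (Wreath.base (FreeAb.gen i)).1.left b * 1
    rw [Wreath.base_left, Finset.prod_eq_single i]
    · by_cases hb : b = 1
      · subst hb
        simp [foxBar, foxDeriv_of, MonoidAlgebra.one_def]
      · simp [foxBar, foxDeriv_of, MonoidAlgebra.one_def, hb]
    · intro j _ hj
      simp [foxBar, foxDeriv_of, hj.symm]
    · simp
  · change QuotientGroup.mk' N (FreeGroup.of i) = 1 * QuotientGroup.mk' N (FreeGroup.of i)
    rw [one_mul]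

/-- The generators used for the word metric on `F / N'` generate. -/
theorem closure_quotGens : Subgroup.closure (quotGens N) = ⊤ := by
  have : quotGens N = QuotientGroup.mk' ⁅N, N⁆ '' Set.range FreeGroup.of := by
    rw [← Set.range_comp]; rfl
  rw [this, ← MonoidHom.map_closure, FreeGroup.closure_range_of, ← MonoidHom.range_eq_map,
    MonoidHom.range_eq_top]
  exact QuotientGroup.mk'_surjective _

/-- The generators used for the word metric on `ℤ^r ≀ (F / N)` generate. -/
theorem closure_wreathGens : Subgroup.closure (wreathGens N) = ⊤ := by
  classical
  set H := Subgroup.closure (wreathGens N) with hH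
  have htop : ∀ b, Wreath.top b ∈ H := by
    let T : (FreeGroup (Fin r) ⧸ N) →* Wreath (FreeAb r) (FreeGroup (Fin r) ⧸ N) :=
      MonoidHom.mk' Wreath.top (by
        intro a b; apply Subtype.ext; apply RegularWreathProduct.ext
        · funext x; exact (one_mul _).symm
        · rfl)
    have : (H.comap (T.comp (QuotientGroup.mk' N))) = ⊤ := by
      rw [eq_top_iff, ← FreeGroup.closure_range_of, Subgroup.closure_le]
      rintro _ ⟨i, rfl⟩
      exact Subgroup.subset_closure (Or.inr ⟨i, rfl⟩)
    intro b
    obtain ⟨g, rfl⟩ := QuotientGroup.mk'_surjective N b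
    have hg : g ∈ (H.comap (T.comp (QuotientGroup.mk' N))) := by rw [this]; trivial
    exact hg
  have hbase : ∀ a : FreeAb r, Wreath.base a ∈ H := by
    let S : FreeAb r →* Wreath (FreeAb r) (FreeGroup (Fin r) ⧸ N) :=
      MonoidHom.mk' Wreath.base (by
        intro a b; apply Subtype.ext; apply RegularWreathProduct.ext
        · funext x
          change (Wreath.base (a * b)).1.left x =
            (Wreath.base a).1.left x * (Wreath.base b).1.left (1⁻¹ * x)
          simp only [Wreath.base_left, inv_one, one_mul]
          split_ifs <;> simp
        · exact (one_mul _).symm)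
    intro a
    have ha : a = ∏ i, FreeAb.gen i ^ (Multiplicative.toAdd a i) := by
      apply Multiplicative.toAdd.injective
      funext j
      simp [FreeAb.gen, Finset.sum_apply, Pi.single_apply]
    have hmem : a ∈ H.comap S := by
      rw [ha]
      exact Subgroup.prod_mem _ fun i _ => Subgroup.zpow_mem (H.comap S)
        (show S (FreeAb.gen i) ∈ H from Subgroup.subset_closure (Or.inl ⟨i, rfl⟩)) _
    exact hmem
  have hfun : ∀ (s : Finset (FreeGroup (Fin r) ⧸ N)) (w : Wreath (FreeAb r) _),
      Function.mulSupport w.1.left ⊆ s → w.1.right = 1 → w ∈ H := by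
    intro s
    induction s using Finset.induction_on with
    | empty =>
      intro w hw hr
      have : w = 1 := by
        apply Subtype.ext; apply RegularWreathProduct.ext
        · exact Function.mulSupport_eq_empty_iff.1 (by simpa using hw)
        · exact hr
      rw [this]; exact H.one_mem
    | insert c s hc ih =>
      intro w hw hr
      have hu : Wreath.top c * Wreath.base (w.1.left c) * (Wreath.top c)⁻¹ ∈ H :=
        H.mul_mem (H.mul_mem (htop c) (hbase _)) (H.inv_mem (htop c))
      set u := Wreath.top c * Wreath.base (w.1.left c) * (Wreath.top c)⁻¹ with hudef
      have hur : u.1.right = 1 := by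
        change c * 1 * c⁻¹ = 1
        simp
      have hul : ∀ x, u.1.left x = if x = c then w.1.left c else 1 := by
        intro x
        change 1 * (Wreath.base (w.1.left c)).1.left (c⁻¹ * x) * 1⁻¹ = _
        simp only [one_mul, inv_one, mul_one, Wreath.base_left, inv_mul_eq_one, eq_comm]
      have hv : u⁻¹ * w ∈ H := by
        apply ih
        · intro x hx
          have hx' : (u.1.left (u.1.right * x))⁻¹ * w.1.left ((u.1.right⁻¹)⁻¹ * x) ≠ 1 := hx
          rw [hur, inv_one, inv_one, one_mul, hul] at hx'
          by_cases hxc : x = c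
          · simp [hxc] at hx'
          · have : x ∈ (↑(insert c s) : Set (FreeGroup (Fin r) ⧸ N)) :=
              hw (by simpa [hxc] using hx')
            simpa [hxc] using this
        · change u.1.right⁻¹ * w.1.right = 1
          simp [hur, hr]
      simpa using H.mul_mem hu hv
  rw [eq_top_iff]
  intro w _
  have hw : w * (Wreath.top w.1.right)⁻¹ ∈ H := by
    have hfin : (Function.mulSupport w.1.left).Finite := w.2
    refine hfun hfin.toFinset _ ?_ ?_
    · intro x hx
      have hx' : w.1.left x * 1⁻¹ ≠ 1 := hx
      simpa using hx'
    · change w.1.right * w.1.right⁻¹ = 1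
      simp
  simpa using H.mul_mem hw (htop w.1.right)

end MagnusEmbedding

end

/-! Read `φ(w)` as a chain of edges in the Cayley graph of `B = F/N`: the value of its function part
at `b` counts, with sign, the edges leaving `b` that the path of `w` crosses. This chain and the
endpoint determine `w`, because `N/N'` is abelian: choosing a section of `F/N' → B` gives a cocycle
with values in `N/N'` from whose value on the chain `w` is recovered (`pairing_eq`,
`sectionCochain_inj`).

For the lower bound, take a shortest word for `φ(w)`. Its top letters trace a path `W` from `1`, and
its lamp letters give a multiset `E` of edges with an endpoint on `W` (`hasDescription_of_isWord`).
Testing `E` against potentials shows that its boundary is that of a path from `1` to the image of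
`w`, so `E` splits into a trail `t` and a cycle (`HasBoundary.exists_trail`). The path `W W⁻¹ t`
passes every vertex of `W`, so the loops of the cycle can be inserted into it
(`HasBoundary.exists_insert`). The resulting word has the same chain and endpoint as `w`, hence
equals `w`, and its length is `2|W| + |E|`, at most twice that of the shortest word.

The upper bound replaces each letter by two. Both bounds thus hold with the factor 2, and
injectivity follows from the first. -/

noncomputable section

namespace MagnusEmbedding

/-! ### Words and word norms -/

section WordNorm

variable {G : Type*} [Group G]

/-- `IsWord S l`: every entry of `l` is an element of `S` or the inverse of one. -/
def IsWord (S : Set G) (l : List G) : Prop := ∀ y ∈ l, y ∈ S ∨ y⁻¹ ∈ S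

theorem isWord_nil (S : Set G) : IsWord S [] := by simp [IsWord]

theorem isWord_cons {S : Set G} {y : G} {l : List G} :
    IsWord S (y :: l) ↔ (y ∈ S ∨ y⁻¹ ∈ S) ∧ IsWord S l := by
  simp [IsWord]

theorem isWord_append {S : Set G} {l m : List G} :
    IsWord S (l ++ m) ↔ IsWord S l ∧ IsWord S m := by
  simp [IsWord, or_imp, forall_and]

theorem IsWord.inv_reverse {S : Set G} {l : List G} (h : IsWord S l) :
    IsWord S (l.map fun y => y⁻¹).reverse := by
  intro y hy
  simp only [List.mem_reverse, List.mem_map] at hy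
  obtain ⟨z, hz, rfl⟩ := hy
  simpa [or_comm] using h z hz

theorem wordNorm_le {S : Set G} {l : List G} (h : IsWord S l) :
    wordNorm S l.prod ≤ l.length :=
  Nat.sInf_le ⟨l, h, rfl, rfl⟩

/-- Generation makes the set of lengths nonempty, so its infimum is attained and is not the default
value `0` of `sInf ∅`. -/
theorem exists_word {S : Set G} (hS : Subgroup.closure S = ⊤) (g : G) :
    ∃ l : List G, IsWord S l ∧ l.prod = g ∧ l.length = wordNorm S g := by
  have hg : g ∈ Subgroup.closure S := hS ▸ Subgroup.mem_top g
  rw [← Subgroup.mem_toSubmonoid, Subgroup.closure_toSubmonoid] at hg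
  obtain ⟨l, hl, hlg⟩ := Submonoid.exists_list_of_mem_closure hg
  exact Nat.sInf_mem (s := {n : ℕ | ∃ l : List G, (∀ y ∈ l, y ∈ S ∨ y⁻¹ ∈ S) ∧ l.prod = g ∧
    l.length = n}) ⟨l.length, l, hl, hlg, rfl⟩

end WordNorm

/-! ### Multiplication by generators in the wreath product -/

section Wreath

variable {A B : Type*} [Group A] [Group B]

theorem Wreath.ext {u v : Wreath A B} (hl : u.1.left = v.1.left) (hr : u.1.right = v.1.right) :
    u = v :=
  Subtype.ext (RegularWreathProduct.ext hl hr)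

theorem Wreath.base_inv (a : A) : (Wreath.base a : Wreath A B)⁻¹ = Wreath.base a⁻¹ := by
  classical
  refine Wreath.ext (funext fun b => ?_) (inv_one (G := B))
  change ((Wreath.base a : Wreath A B).1.left (1 * b))⁻¹ = _
  rw [one_mul, Wreath.base_left, Wreath.base_left]
  split_ifs <;> simp

theorem Wreath.top_inv (b : B) : (Wreath.top b : Wreath A B)⁻¹ = Wreath.top b⁻¹ :=
  Wreath.ext (funext fun _ => inv_one (G := A)) rfl

theorem Wreath.mul_top_left (u : Wreath A B) (b : B) :
    (u * Wreath.top b).1.left = u.1.left :=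
  funext fun _ => mul_one _

theorem Wreath.mul_base_left [DecidableEq B] (u : Wreath A B) (a : A) :
    (u * Wreath.base a).1.left = u.1.left * Pi.mulSingle u.1.right a := by
  funext b
  change u.1.left b * (Wreath.base a : Wreath A B).1.left (u.1.right⁻¹ * b) = _
  rw [Wreath.base_left, Pi.mul_apply, Pi.mulSingle_apply]
  simp only [inv_mul_eq_one, eq_comm]

theorem Wreath.mul_base_right (u : Wreath A B) (a : A) :
    (u * Wreath.base a).1.right = u.1.right :=
  mul_one _

/-- The projection of the wreath product to its second factor. -/
def Wreath.proj : Wreath A B →* B where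
  toFun u := u.1.right
  map_one' := rfl
  map_mul' _ _ := rfl

end Wreath

/-! ### Evaluating cochains on lists of edges -/

section ChainProd

variable {G B K : Type} [CommGroup K] {χ : B → G → K}

/-- The product of the values of a cochain along a list of paths. -/
def chainProd (χ : B → G → K) (E : List (B × G)) : K := (E.map fun e => χ e.1 e.2).prod

@[simp] theorem chainProd_nil : chainProd χ [] = 1 := rfl

@[simp] theorem chainProd_cons (e : B × G) (E : List (B × G)) :
    chainProd χ (e :: E) = χ e.1 e.2 * chainProd χ E := by
  simp [chainProd]

@[simp] theorem chainProd_append (E E' : List (B × G)) :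
    chainProd χ (E ++ E') = chainProd χ E * chainProd χ E' := by
  simp [chainProd]

theorem chainProd_perm {E E' : List (B × G)} (h : E.Perm E') :
    chainProd χ E = chainProd χ E' :=
  (h.map _).prod_eq

end ChainProd

/-! ### Cocycles: potentials and the section cocycle -/

section Cocycle

open scoped IsMulCommutative

variable {G B : Type} [Group G] [Group B]

/-- `χ p g` is the value of a cochain along the path labelled `g` that starts at `p`; it is a
cocycle if it is multiplicative under concatenation of paths. -/
def IsCocycle {K : Type} [CommGroup K] (Q : G →* B) (χ : B → G → K) : Prop :=
  ∀ p g h, χ p (g * h) = χ p g * χ (p * Q g) h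

section

variable {K : Type} [CommGroup K] {Q : G →* B} {χ : B → G → K}

theorem IsCocycle.map_one (hχ : IsCocycle Q χ) (p : B) : χ p 1 = 1 := by
  have h := hχ p 1 1
  rw [mul_one, _root_.map_one, mul_one] at h
  exact left_eq_mul.1 h

theorem IsCocycle.map_inv (hχ : IsCocycle Q χ) (p : B) (g : G) :
    χ (p * Q g) g⁻¹ = (χ p g)⁻¹ := by
  rw [eq_inv_iff_mul_eq_one, mul_comm, ← hχ, mul_inv_cancel, hχ.map_one]

end

/-- Coboundaries telescope along a path. Pairing with them detects the boundary of a chain. -/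
theorem isCocycle_potential (Q : G →* B) (k : B → ℤ) :
    IsCocycle Q fun p g => Multiplicative.ofAdd (k (p * Q g) - k p) := by
  intro p g h
  dsimp only
  rw [← ofAdd_add, map_mul, mul_assoc]
  congr 1
  ring

/-- The chain with values in the kernel of `Q` that compares paths with a section of `Q`. -/
def sectionCochain (Q : G →* B) (τ : B → G) (hτ : ∀ b, Q (τ b) = b) (p : B) (g : G) : Q.ker :=
  ⟨τ p * g * (τ (p * Q g))⁻¹, by simp [MonoidHom.mem_ker, hτ]⟩

/-- The inner factors `τ` cancel under concatenation. Commutativity of the kernel makes it an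
admissible coefficient group, so that values on chains do not depend on the order of the edges. -/
theorem isCocycle_sectionCochain (Q : G →* B) [IsMulCommutative Q.ker] (τ : B → G)
    (hτ : ∀ b, Q (τ b) = b) : IsCocycle Q (sectionCochain Q τ hτ) := by
  intro p g h
  apply Subtype.ext
  simp [sectionCochain, mul_assoc]

theorem sectionCochain_inj (Q : G →* B) (τ : B → G) (hτ : ∀ b, Q (τ b) = b) {p : B} {g h : G}
    (hQ : Q g = Q h) (hc : sectionCochain Q τ hτ p g = sectionCochain Q τ hτ p h) : g = h := by
  have := congrArg Subtype.val hc
  simpa [sectionCochain, hQ] using this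

end Cocycle

/-! ### Pairing chains with cocycles -/

section Pairing

variable {G B K : Type} [CommGroup K] {r : ℕ}

/-- The homomorphism `ℤ^r → K` with prescribed values on the standard generators. -/
def FreeAb.lift (k : Fin r → K) : FreeAb r →* K where
  toFun a := ∏ i, k i ^ (Multiplicative.toAdd a i)
  map_one' := by simp
  map_mul' a b := by simp [zpow_add, Finset.prod_mul_distrib]

theorem FreeAb.lift_gen (k : Fin r → K) (i : Fin r) : FreeAb.lift k (FreeAb.gen i) = k i := by
  change ∏ j, k j ^ ((Pi.single i 1 : Fin r → ℤ) j) = k i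
  rw [Finset.prod_eq_single i]
  · simp
  · intro j _ hj
    simp [hj]
  · simp

/-- The pairing of a finitely supported function `B → ℤ^r`, seen as a chain of edges of the Cayley
graph of `B`, with the cochain `χ`. -/
def pairing (x : Fin r → G) (χ : B → G → K) (f : B → FreeAb r) : K :=
  ∏ᶠ b, FreeAb.lift (fun i => χ b (x i)) (f b)

theorem pairing_one (x : Fin r → G) (χ : B → G → K) : pairing x χ 1 = 1 := by
  simp [pairing]

theorem pairing_mul_mulSingle [DecidableEq B] (x : Fin r → G) (χ : B → G → K) {f : B → FreeAb r}
    (hf : (Function.mulSupport f).Finite) (p : B) (a : FreeAb r) :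
    pairing x χ (f * Pi.mulSingle p a) =
      pairing x χ f * FreeAb.lift (fun i => χ p (x i)) a := by
  have hsub : ∀ h : B → FreeAb r, (Function.mulSupport h).Finite →
      (Function.mulSupport fun b => FreeAb.lift (fun i => χ b (x i)) (h b)).Finite := by
    intro h hh
    refine hh.subset fun b hb hb' => hb ?_
    simp [hb']
  have hs : (Function.mulSupport (Pi.mulSingle p a : B → FreeAb r)).Finite :=
    (Set.finite_singleton p).subset Pi.mulSupport_mulSingle_subset
  simp only [pairing, Pi.mul_apply, map_mul]
  -- Finite supports are essential here, since `∏ᶠ` takes the default value `1` on infinite support.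
  rw [finprod_mul_distrib (hsub _ hf) (hsub _ hs)]
  congr 1
  rw [finprod_eq_single _ p]
  · simp
  · intro b hb
    simp [hb]

variable [Group G] [Group B] {Q : G →* B} {x : Fin r → G} {φ : G →* Wreath (FreeAb r) B}

/-- Appending a letter `x i` to `g` adds one edge at the vertex `Q g` to the chain, so both sides
gain the same factor `χ (Q g) (x i)`. -/
theorem pairing_eq (hx : Subgroup.closure (Set.range x) = ⊤)
    (hφ : ∀ i, φ (x i) = Wreath.base (FreeAb.gen i) * Wreath.top (Q (x i)))
    (hQ : ∀ g, (φ g).1.right = Q g) {χ : B → G → K} (hχ : IsCocycle Q χ) (g : G) :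
    pairing x χ (φ g).1.left = χ 1 g := by
  classical
  have step : ∀ g i, pairing x χ (φ (g * x i)).1.left =
      pairing x χ (φ g).1.left * χ (Q g) (x i) := by
    intro g i
    rw [map_mul, hφ, ← mul_assoc, Wreath.mul_top_left, Wreath.mul_base_left,
      pairing_mul_mulSingle _ _ (φ g).2, FreeAb.lift_gen, hQ]
  have step' : ∀ g i, χ 1 (g * x i) = χ 1 g * χ (Q g) (x i) := by
    intro g i
    rw [hχ, one_mul]
  have hg : g ∈ Subgroup.closure (Set.range x) := hx ▸ Subgroup.mem_top g
  induction hg using Subgroup.closure_induction_right with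
  | one =>
    rw [map_one, hχ.map_one]
    exact pairing_one x χ
  | mul_right g _ y hy ih =>
    obtain ⟨i, rfl⟩ := hy
    rw [step, step', ih]
  | mul_inv_cancel g _ y hy ih =>
    -- An inverse letter is handled by applying the positive step at `g * (x i)⁻¹` and cancelling.
    obtain ⟨i, rfl⟩ := hy
    have h1 := step (g * (x i)⁻¹) i
    have h2 := step' (g * (x i)⁻¹) i
    rw [inv_mul_cancel_right] at h1 h2
    rw [h1, h2] at ih
    exact mul_right_cancel ih

end Pairing

/-! ### Decomposing chains into trails and loops -/

section Trails

variable {G B : Type} [Group G] [Group B]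

/-- The path labelled `l` that starts at `1` passes through the vertex `p`. -/
def Visits (Q : G →* B) (l : List G) (p : B) : Prop := ∃ m n, l = m ++ n ∧ Q m.prod = p

theorem Visits.append {Q : G →* B} {l : List G} {p : B} (h : Visits Q l p) (l' : List G) :
    Visits Q (l ++ l') p := by
  obtain ⟨m, n, rfl, hp⟩ := h
  exact ⟨m, n ++ l', List.append_assoc _ _ _, hp⟩

theorem visits_prod (Q : G →* B) (l : List G) : Visits Q l (Q l.prod) :=
  ⟨l, [], by simp, rfl⟩

theorem Visits.insert {Q : G →* B} {m n : List G} {p : B} (h : Visits Q (m ++ n) p)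
    {l : List G} (hl : Q l.prod = 1) : Visits Q (m ++ l ++ n) p := by
  obtain ⟨u, v, huv, hp⟩ := h
  rcases List.append_eq_append_iff.1 huv with ⟨w, rfl, rfl⟩ | ⟨w, rfl, rfl⟩
  · exact ⟨m ++ l ++ w, v, by simp, by simpa [hl] using hp⟩
  · exact ⟨u, w ++ l ++ n, by simp, hp⟩

/-- The edge `e` has an endpoint on the path labelled `l`. -/
def Touches (Q : G →* B) (l : List G) (e : B × G) : Prop :=
  Visits Q l e.1 ∨ Visits Q l (e.1 * Q e.2)

/-- The chain `E` has boundary `b - a`. -/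
def HasBoundary (Q : G →* B) (E : List (B × G)) (a b : B) : Prop :=
  ∀ k : B → ℤ, (E.map fun e => k (e.1 * Q e.2) - k e.1).sum = k b - k a

theorem HasBoundary.perm {Q : G →* B} {E E' : List (B × G)} {a b : B}
    (h : HasBoundary Q E a b) (hE : E.Perm E') : HasBoundary Q E' a b := fun k => by
  rw [← h k]
  exact ((hE.map _).sum_eq).symm

/-- Test the boundary on the indicator of `a`: it gives `-1`, whereas edges that do not start at `a`
contribute nonnegatively. -/
theorem HasBoundary.exists_src {Q : G →* B} {E : List (B × G)} {a b : B}
    (h : HasBoundary Q E a b) (hab : a ≠ b) : ∃ y, (a, y) ∈ E := by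
  classical
  by_contra! hcon
  have hk := h (Pi.single a 1)
  have : 0 ≤ (E.map fun e => (Pi.single a 1 : B → ℤ) (e.1 * Q e.2) -
      (Pi.single a 1 : B → ℤ) e.1).sum := by
    refine List.sum_nonneg fun z hz => ?_
    obtain ⟨e, he, rfl⟩ := List.mem_map.1 hz
    have hea : e.1 ≠ a := fun hea => hcon e.2 (hea ▸ he)
    simp only [Pi.single_apply, hea, if_false]
    split_ifs <;> simp
  rw [hk] at this
  simp [hab.symm] at this

theorem HasBoundary.of_cons {Q : G →* B} {E : List (B × G)} {a b p : B} {y : G}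
    (h : HasBoundary Q ((p, y) :: E) a b) (k : B → ℤ) :
    (E.map fun e => k (e.1 * Q e.2) - k e.1).sum = k b - k a - (k (p * Q y) - k p) := by
  rw [← h k]
  simp

/-- A chain with boundary `b - a` splits into a trail from `a` to `b` and a cycle. -/
theorem HasBoundary.exists_trail {Q : G →* B} (S : Set G) :
    ∀ (n : ℕ) (E : List (B × G)) (a b : B), E.length = n → HasBoundary Q E a b →
      (∀ e ∈ E, e.2 ∈ S ∨ e.2⁻¹ ∈ S) →
      ∃ (l : List G) (E' : List (B × G)), IsWord S l ∧ a * Q l.prod = b ∧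
        HasBoundary Q E' 1 1 ∧ E' ⊆ E ∧ l.length + E'.length = E.length ∧
        ∀ (K : Type) [CommGroup K] (χ : B → G → K), IsCocycle Q χ →
          chainProd χ E = χ a l.prod * chainProd χ E' := by
  classical
  intro n
  induction n with
  | zero =>
    intro E a b hn h hS
    obtain rfl : E = [] := List.length_eq_zero_iff.1 hn
    have hab : a = b := by
      by_contra hab
      obtain ⟨y, hy⟩ := h.exists_src hab
      simp at hy
    subst hab
    refine ⟨[], [], isWord_nil S, by simp, fun k => by simp, by simp, rfl, ?_⟩
    intro K _ χ hχ
    simp [hχ.map_one]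
  | succ n ih =>
    intro E a b hn h hS
    by_cases hab : a = b
    · subst hab
      refine ⟨[], E, isWord_nil S, by simp, fun k => by simpa using h k, by simp, by simp, ?_⟩
      intro K _ χ hχ
      simp [hχ.map_one]
    -- Greedy walk: cross an edge leaving `a` and delete it; the rest has boundary `b - a * Q y`.
    -- The walk stops on reaching `b`, and the unused edges form the cycle.
    · obtain ⟨y, hy⟩ := h.exists_src hab
      have hperm := List.perm_cons_erase hy
      have hlen := hperm.length_eq
      rw [List.length_cons] at hlen
      obtain ⟨l, E', hl, hlb, hE', hsub, hlen', hχ'⟩ := ih (E.erase (a, y)) (a * Q y) b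
        (by omega) (fun k => by rw [(h.perm hperm).of_cons k]; ring)
        (fun e he => hS e (List.mem_of_mem_erase he))
      refine ⟨y :: l, E', isWord_cons.2 ⟨hS _ hy, hl⟩, by simpa [mul_assoc] using hlb, hE',
        fun e he => List.mem_of_mem_erase (hsub he), by simp; omega, ?_⟩
      intro K _ χ hχ
      rw [chainProd_perm hperm, chainProd_cons, hχ' K χ hχ, List.prod_cons, hχ, mul_assoc]

/-- The loops of a cycle each of whose edges has an endpoint on a path can be inserted into the
path. -/
theorem HasBoundary.exists_insert {Q : G →* B} (S : Set G) :
    ∀ (n : ℕ) (E : List (B × G)) (l : List G), E.length ≤ n → HasBoundary Q E 1 1 →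
      (∀ e ∈ E, e.2 ∈ S ∨ e.2⁻¹ ∈ S) → IsWord S l → (∀ e ∈ E, Touches Q l e) →
      ∃ l' : List G, IsWord S l' ∧ Q l'.prod = Q l.prod ∧ l'.length = l.length + E.length ∧
        ∀ (K : Type) [CommGroup K] (χ : B → G → K), IsCocycle Q χ →
          χ 1 l'.prod = χ 1 l.prod * chainProd χ E := by
  intro n
  induction n with
  | zero =>
    intro E l hn _ _ hl _
    obtain rfl : E = [] := List.length_eq_zero_iff.1 (by omega)
    exact ⟨l, hl, rfl, by simp, fun K _ χ hχ => by simp⟩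
  | succ n ih =>
    intro E l hn hE hS hl ht
    rcases E with _ | ⟨⟨a, y⟩, E⟩
    · exact ⟨l, hl, rfl, by simp, fun K _ χ hχ => by simp⟩
    simp only [List.length_cons] at hn
    simp only [List.forall_mem_cons] at hS ht
    -- Without the edge `(a, y)` the cycle has boundary `a - a * Q y`, so it contains a trail
    -- closing this edge to a loop.
    obtain ⟨t, E', ht', hta, hE', hsub, hlen, hχ'⟩ := HasBoundary.exists_trail S E.length E
      (a * Q y) a rfl (fun k => by rw [hE.of_cons k]; ring) hS.2
    have hQ : Q y * Q t.prod = 1 := by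
      rw [mul_assoc] at hta
      exact mul_eq_left.1 hta
    have hQ' : Q t.prod * Q y = 1 := mul_eq_one_comm.1 hQ
    -- The loop is read from whichever endpoint of the edge lies on the path: as `y t` from `a`, or
    -- as `t y` from `a * Q y`.
    obtain ⟨p, m, hvis, hm, hQm, hmlen, hχm⟩ : ∃ (p : B) (m : List G), Visits Q l p ∧
        IsWord S m ∧ Q m.prod = 1 ∧ m.length = t.length + 1 ∧
        ∀ (K : Type) [CommGroup K] (χ : B → G → K), IsCocycle Q χ →
          χ p m.prod = χ a y * χ (a * Q y) t.prod := by
      rcases ht.1 with h | h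
      · refine ⟨a, y :: t, h, isWord_cons.2 ⟨hS.1, ht'⟩, by simpa using hQ, rfl, ?_⟩
        intro K _ χ hχ
        rw [List.prod_cons, hχ]
      · refine ⟨a * Q y, t ++ [y], h,
          isWord_append.2 ⟨ht', isWord_cons.2 ⟨hS.1, isWord_nil S⟩⟩, by simpa using hQ',
          by simp, ?_⟩
        intro K _ χ hχ
        rw [List.prod_append, List.prod_singleton, hχ, hta, mul_comm]
    obtain ⟨u, v, rfl, hp⟩ := hvis
    rw [isWord_append] at hl
    -- Inserting a loop keeps every visited vertex, so the remaining edges still touch the new path.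
    obtain ⟨l', hl', hQl, hlen', hχl⟩ := ih E' (u ++ m ++ v) (by omega) hE'
      (fun e he => hS.2 e (hsub he)) (isWord_append.2 ⟨isWord_append.2 ⟨hl.1, hm⟩, hl.2⟩)
      (fun e he => (ht.2 e (hsub he)).imp (fun h => h.insert hQm) (fun h => h.insert hQm))
    refine ⟨l', hl', by simp [hQl, hQm], ?_, ?_⟩
    · simp only [List.length_append, List.length_cons] at hlen' ⊢
      omega
    · intro K _ χ hχ
      rw [hχl K χ hχ, chainProd_cons, hχ' K χ hχ, List.prod_append, List.prod_append,
        List.prod_append, hχ, hχ 1 u.prod, hχ 1 u.prod, map_mul, hQm, mul_one, one_mul, hp,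
        hχm K χ hχ]
      simp only [mul_assoc, mul_comm, mul_left_comm]

end Trails

/-! ### Comparison of word lengths for an abelian kernel -/

section Length

open scoped IsMulCommutative

variable {G B : Type} [Group G] [Group B] {r : ℕ} {Q : G →* B} {x : Fin r → G}

/-- The generators of `ℤ^r ≀ B` attached to the letters `x i`. -/
def lampGens (Q : G →* B) (x : Fin r → G) : Set (Wreath (FreeAb r) B) :=
  Set.range (fun i : Fin r => Wreath.base (FreeAb.gen i)) ∪
    Set.range (fun i : Fin r => Wreath.top (Q (x i)))

/-- The element `u` of the wreath product is described by a path in the Cayley graph of `B` and a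
chain of edges which touch it, of total length `n`. -/
def HasDescription (Q : G →* B) (x : Fin r → G) (n : ℕ) (u : Wreath (FreeAb r) B) : Prop :=
  ∃ (E : List (B × G)) (W : List G), E.length + W.length = n ∧
    IsWord (Set.range x) W ∧ (∀ e ∈ E, e.2 ∈ Set.range x ∨ e.2⁻¹ ∈ Set.range x) ∧
    Q W.prod = u.1.right ∧ (∀ e ∈ E, Touches Q W e) ∧
    ∀ (K : Type) [CommGroup K] (χ : B → G → K), IsCocycle Q χ →
      pairing x χ u.1.left = chainProd χ E

/-- A top letter extends the path, while a lamp letter adds an edge at the current vertex, so each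
letter costs exactly one. -/
theorem hasDescription_of_isWord (l : List (Wreath (FreeAb r) B)) (hl : IsWord (lampGens Q x) l) :
    HasDescription Q x l.length l.prod := by
  classical
  induction l using List.reverseRecOn with
  | nil =>
    refine ⟨[], [], rfl, isWord_nil _, by simp, by simp, by simp, ?_⟩
    intro K _ χ _
    exact pairing_one x χ
  | append_singleton l s ih =>
    rw [isWord_append, isWord_cons] at hl
    obtain ⟨E, W, hlen, hW, hE, hQ, ht, hχ⟩ := ih hl.1
    have hlast : ∀ i, ∀ e : B × G, (e = (Q W.prod, x i) ∨ e = (Q W.prod * Q (x i), (x i)⁻¹)) →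
        (e.2 ∈ Set.range x ∨ e.2⁻¹ ∈ Set.range x) ∧ Touches Q W e := by
      rintro i e (rfl | rfl)
      · exact ⟨Or.inl ⟨i, rfl⟩, Or.inl (visits_prod Q W)⟩
      · refine ⟨Or.inr ⟨i, (inv_inv _).symm⟩, Or.inr ?_⟩
        simpa using visits_prod Q W
    have hlamp : ∀ (a : FreeAb r) (e : B × G) (i : Fin r), s = Wreath.base a →
        (e = (Q W.prod, x i) ∨ e = (Q W.prod * Q (x i), (x i)⁻¹)) →
        (∀ (K : Type) [CommGroup K] (χ : B → G → K), IsCocycle Q χ →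
          FreeAb.lift (fun i => χ (Q W.prod) (x i)) a = χ e.1 e.2) →
        HasDescription Q x (l ++ [s]).length (l ++ [s]).prod := by
      intro a e i hs he hχe
      refine ⟨E ++ [e], W, ?_, hW, ?_, ?_, ?_, ?_⟩
      · simp only [List.length_append, List.length_singleton]
        omega
      · intro e' he'
        rcases List.mem_append.1 he' with h | h
        · exact hE e' h
        · rw [List.mem_singleton.1 h]
          exact (hlast i e he).1
      · rw [List.prod_append, List.prod_singleton, hs, Wreath.mul_base_right, hQ]
      · intro e' he'
        rcases List.mem_append.1 he' with h | h
        · exact ht e' h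
        · rw [List.mem_singleton.1 h]
          exact (hlast i e he).2
      · intro K _ χ hχ'
        rw [List.prod_append, List.prod_singleton, hs, Wreath.mul_base_left,
          pairing_mul_mulSingle _ _ l.prod.2, hχ K χ hχ', chainProd_append, chainProd_cons,
          chainProd_nil, mul_one, ← hχe K χ hχ', hQ]
    have hstep : ∀ y : G, (y ∈ Set.range x ∨ y⁻¹ ∈ Set.range x) → s = Wreath.top (Q y) →
        HasDescription Q x (l ++ [s]).length (l ++ [s]).prod := by
      intro y hy hs
      refine ⟨E, W ++ [y], ?_, isWord_append.2 ⟨hW, isWord_cons.2 ⟨hy, isWord_nil _⟩⟩, hE, ?_,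
        fun e he => (ht e he).imp (fun h => h.append _) (fun h => h.append _), ?_⟩
      · simp only [List.length_append, List.length_singleton]
        omega
      · rw [List.prod_append, List.prod_singleton, map_mul, hQ, List.prod_append,
          List.prod_singleton, hs]
        rfl
      · intro K _ χ hχ'
        rw [List.prod_append, List.prod_singleton, hs, Wreath.mul_top_left, hχ K χ hχ']
    rcases hl.2.1 with (⟨i, hi⟩ | ⟨i, hi⟩) | (⟨i, hi⟩ | ⟨i, hi⟩)
    · exact hlamp _ (Q W.prod, x i) i hi.symm (Or.inl rfl)
        fun K _ χ _ => FreeAb.lift_gen _ i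
    · exact hstep (x i) (Or.inl ⟨i, rfl⟩) hi.symm
    -- An inverse lamp letter is the edge traversed backwards; it ends, rather than starts, at the
    -- current vertex.
    · refine hlamp (FreeAb.gen i)⁻¹ (Q W.prod * Q (x i), (x i)⁻¹) i ?_ (Or.inr rfl) ?_
      · rw [← Wreath.base_inv, ← inv_eq_iff_eq_inv]
        exact hi.symm
      · intro K _ χ hχ'
        rw [_root_.map_inv, FreeAb.lift_gen, hχ'.map_inv]
    · refine hstep (x i)⁻¹ (Or.inr ⟨i, (inv_inv _).symm⟩) ?_
      rw [_root_.map_inv, ← Wreath.top_inv, ← inv_eq_iff_eq_inv]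
      exact hi.symm

variable {φ : G →* Wreath (FreeAb r) B}

theorem wordNorm_le_two_mul [IsMulCommutative Q.ker] (hsurj : Function.Surjective Q)
    (hx : Subgroup.closure (Set.range x) = ⊤) (hgen : Subgroup.closure (lampGens Q x) = ⊤)
    (hφ : ∀ i, φ (x i) = Wreath.base (FreeAb.gen i) * Wreath.top (Q (x i)))
    (hQ : ∀ g, (φ g).1.right = Q g) (w : G) :
    wordNorm (Set.range x) w ≤ 2 * wordNorm (lampGens Q x) (φ w) := by
  obtain ⟨l, hl, hlw, hlen⟩ := exists_word hgen (φ w)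
  obtain ⟨E, W, hEW, hW, hE, -, ht, hχ⟩ := hasDescription_of_isWord l hl
  have key : ∀ (K : Type) [CommGroup K] (χ : B → G → K), IsCocycle Q χ →
      χ 1 w = chainProd χ E := by
    intro K _ χ hχ'
    rw [← hχ K χ hχ', hlw, pairing_eq hx hφ hQ hχ']
  -- Evaluate `key` on the potential cocycle of `k`.
  have hbd : HasBoundary Q E 1 (Q w) := by
    intro k
    have h := congrArg Multiplicative.toAdd (key _ _ (isCocycle_potential Q k))
    rw [one_mul, toAdd_ofAdd] at h
    rw [h, chainProd, toAdd_list_sum, List.map_map]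
    rfl
  obtain ⟨t, E', htw, hQt, hE', hsub, hlen', hχt⟩ :=
    HasBoundary.exists_trail (Set.range x) E.length E 1 (Q w) rfl hbd hE
  rw [one_mul] at hQt
  have hWinv : W.prod * (W.map fun y => y⁻¹).reverse.prod = 1 := by
    rw [← List.prod_inv_reverse, mul_inv_cancel]
  -- Running along `W` and back costs `2|W|` and does not change the value `t.prod`, but makes the
  -- path meet every edge of the cycle.
  obtain ⟨l', hl', hQl, hlenl, hχl⟩ := HasBoundary.exists_insert (Q := Q) (Set.range x)
    E'.length E' (W ++ ((W.map fun y => y⁻¹).reverse ++ t)) le_rfl hE'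
    (fun e he => hE e (hsub he)) (isWord_append.2 ⟨hW, isWord_append.2 ⟨hW.inv_reverse, htw⟩⟩)
    (fun e he => (ht e (hsub he)).imp (fun h => h.append _) (fun h => h.append _))
  rw [List.prod_append, List.prod_append, ← mul_assoc, hWinv, one_mul] at hQl hχl
  -- The new word and `w` have the same endpoint and agree on the section cocycle, so they are
  -- equal.
  have hτ := Function.surjInv_eq hsurj
  have hcoc := isCocycle_sectionCochain Q (Function.surjInv hsurj) hτ
  have hw : l'.prod = w := by
    refine sectionCochain_inj Q _ hτ (p := 1) (hQl.trans hQt) ?_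
    rw [hχl _ _ hcoc, key _ _ hcoc, hχt _ _ hcoc]
  calc wordNorm (Set.range x) w ≤ l'.length := hw ▸ wordNorm_le hl'
    _ ≤ 2 * wordNorm (lampGens Q x) (φ w) := by
      simp only [List.length_append, List.length_reverse, List.length_map] at hlenl
      omega

/-- Each letter `x i` maps to one lamp letter times one top letter. -/
theorem wordNorm_map_le (hx : Subgroup.closure (Set.range x) = ⊤)
    (hφ : ∀ i, φ (x i) = Wreath.base (FreeAb.gen i) * Wreath.top (Q (x i))) (w : G) :
    wordNorm (lampGens Q x) (φ w) ≤ 2 * wordNorm (Set.range x) w := by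
  obtain ⟨l, hl, rfl, hlen⟩ := exists_word hx w
  rw [← hlen]
  suffices h : ∃ m, IsWord (lampGens Q x) m ∧ m.prod = φ l.prod ∧ m.length = 2 * l.length by
    obtain ⟨m, hm, hml, hmlen⟩ := h
    rw [← hml, ← hmlen]
    exact wordNorm_le hm
  clear hlen
  induction l with
  | nil => exact ⟨[], isWord_nil _, by simp, rfl⟩
  | cons y l ih =>
    rw [isWord_cons] at hl
    obtain ⟨m, hm, hml, hmlen⟩ := ih hl.2
    have hb : ∀ i, (Wreath.base (FreeAb.gen i)) ∈ lampGens Q x := fun i => Or.inl ⟨i, rfl⟩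
    have ht : ∀ i, (Wreath.top (Q (x i))) ∈ lampGens Q x := fun i => Or.inr ⟨i, rfl⟩
    rcases hl.1 with ⟨i, hi⟩ | ⟨i, hi⟩
    · refine ⟨Wreath.base (FreeAb.gen i) :: Wreath.top (Q (x i)) :: m,
        isWord_cons.2 ⟨Or.inl (hb i), isWord_cons.2 ⟨Or.inl (ht i), hm⟩⟩, ?_, ?_⟩
      · rw [List.prod_cons, List.prod_cons, List.prod_cons, map_mul, hml, ← hi, hφ, mul_assoc]
      · simp only [List.length_cons]
        omega
    · refine ⟨(Wreath.top (Q (x i)))⁻¹ :: (Wreath.base (FreeAb.gen i))⁻¹ :: m,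
        isWord_cons.2 ⟨Or.inr (by rw [inv_inv]; exact ht i),
          isWord_cons.2 ⟨Or.inr (by rw [inv_inv]; exact hb i), hm⟩⟩, ?_, ?_⟩
      · rw [List.prod_cons, List.prod_cons, List.prod_cons, map_mul, hml,
          ← inv_inv y, ← hi, _root_.map_inv, hφ, mul_inv_rev, mul_assoc]
      · simp only [List.length_cons]
        omega

end Length

/-! ### The Magnus embedding -/

section Magnus

variable {r : ℕ} (N : Subgroup (FreeGroup (Fin r))) [N.Normal]

/-- The projection `F / N' → F / N`. -/
def quotProj : FreeGroup (Fin r) ⧸ ⁅N, N⁆ →* FreeGroup (Fin r) ⧸ N :=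
  Wreath.proj.comp (magnus N)

theorem quotProj_mk (g : FreeGroup (Fin r)) :
    quotProj N (QuotientGroup.mk' ⁅N, N⁆ g) = QuotientGroup.mk' N g :=
  rfl

theorem quotProj_surjective : Function.Surjective (quotProj N) := by
  intro b
  obtain ⟨g, rfl⟩ := QuotientGroup.mk'_surjective N b
  exact ⟨_, quotProj_mk N g⟩

instance isMulCommutative_ker_quotProj : IsMulCommutative (quotProj N).ker := by
  refine ⟨⟨?_⟩⟩
  rintro ⟨u, hu⟩ ⟨v, hv⟩
  obtain ⟨g, rfl⟩ := QuotientGroup.mk'_surjective _ u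
  obtain ⟨h, rfl⟩ := QuotientGroup.mk'_surjective _ v
  rw [MonoidHom.mem_ker, quotProj_mk] at hu hv
  have hg : g ∈ N := (QuotientGroup.eq_one_iff g).1 hu
  have hh : h ∈ N := (QuotientGroup.eq_one_iff h).1 hv
  apply Subtype.ext
  change QuotientGroup.mk' ⁅N, N⁆ g * QuotientGroup.mk' ⁅N, N⁆ h =
    QuotientGroup.mk' ⁅N, N⁆ h * QuotientGroup.mk' ⁅N, N⁆ g
  rw [← commutatorElement_eq_one_iff_mul_comm, ← map_commutatorElement]
  exact (QuotientGroup.eq_one_iff _).2 (Subgroup.commutator_mem_commutator hg hh)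

theorem wordNorm_quotGens_le (w : FreeGroup (Fin r) ⧸ ⁅N, N⁆) :
    wordNorm (quotGens N) w ≤ 2 * wordNorm (wreathGens N) (magnus N w) :=
  wordNorm_le_two_mul (quotProj_surjective N) (closure_quotGens N) (closure_wreathGens N)
    (magnus_of N) (fun _ => rfl) w

theorem wordNorm_magnus_le (w : FreeGroup (Fin r) ⧸ ⁅N, N⁆) :
    wordNorm (wreathGens N) (magnus N w) ≤ 2 * wordNorm (quotGens N) w :=
  wordNorm_map_le (Q := quotProj N) (closure_quotGens N) (magnus_of N) w

/-- An element of the kernel has word norm at most `2 * 0`, so the empty word represents it. -/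
theorem magnus_injective : Function.Injective (magnus N) := by
  refine (injective_iff_map_eq_one _).2 fun w hw => ?_
  have h0 : wordNorm (wreathGens N) (magnus N w) ≤ 0 := by
    rw [hw]
    exact wordNorm_le (isWord_nil _)
  have h1 := wordNorm_quotGens_le N w
  obtain ⟨l, -, rfl, hlen⟩ := exists_word (closure_quotGens N) w
  obtain rfl : l = [] := List.length_eq_zero_iff.1 (by omega)
  rfl

/-- The constants `2 * (r + 1)` and `3` only weaken the factor 2 of the two preceding estimates. -/
theorem magnus_bounds (w : FreeGroup (Fin r) ⧸ ⁅N, N⁆) :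
    1 / (2 * ((r : ℝ) + 1)) * (wordNorm (quotGens N) w : ℝ)
        ≤ (wordNorm (wreathGens N) (magnus N w) : ℝ) ∧
      (wordNorm (wreathGens N) (magnus N w) : ℝ) ≤ 3 * (wordNorm (quotGens N) w : ℝ) := by
  have h1 : (wordNorm (quotGens N) w : ℝ) ≤ 2 * wordNorm (wreathGens N) (magnus N w) := by
    exact_mod_cast wordNorm_quotGens_le N w
  have h2 : (wordNorm (wreathGens N) (magnus N w) : ℝ) ≤ 2 * wordNorm (quotGens N) w := by
    exact_mod_cast wordNorm_magnus_le N w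
  have h3 : (0 : ℝ) ≤ wordNorm (quotGens N) w := Nat.cast_nonneg _
  have h4 : (0 : ℝ) ≤ wordNorm (wreathGens N) (magnus N w) := Nat.cast_nonneg _
  refine ⟨?_, by linarith⟩
  rw [one_div, inv_mul_le_iff₀ (by positivity)]
  have h5 : 0 ≤ (r : ℝ) * wordNorm (wreathGens N) (magnus N w) := by positivity
  linarith

end Magnus

end MagnusEmbedding

end

theorem mainTheorem1 (r : ℕ) (N : Subgroup (FreeGroup (Fin r))) [N.Normal] :
    (∀ w : FreeGroup (Fin r) ⧸ ⁅N, N⁆,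
      1 / (2 * ((r : ℝ) + 1)) * (MagnusEmbedding.wordNorm (MagnusEmbedding.quotGens N) w : ℝ)
          ≤ (MagnusEmbedding.wordNorm (MagnusEmbedding.wreathGens N)
              (MagnusEmbedding.magnus N w) : ℝ) ∧
      (MagnusEmbedding.wordNorm (MagnusEmbedding.wreathGens N)
              (MagnusEmbedding.magnus N w) : ℝ)
          ≤ 3 * (MagnusEmbedding.wordNorm (MagnusEmbedding.quotGens N) w : ℝ)) ∧
    (∀ u v : FreeGroup (Fin r) ⧸ ⁅N, N⁆,
      1 / (2 * ((r : ℝ) + 1)) * (MagnusEmbedding.wordDist (MagnusEmbedding.quotGens N) u v : ℝ)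
          ≤ (MagnusEmbedding.wordDist (MagnusEmbedding.wreathGens N)
              (MagnusEmbedding.magnus N u) (MagnusEmbedding.magnus N v) : ℝ) ∧
      (MagnusEmbedding.wordDist (MagnusEmbedding.wreathGens N)
              (MagnusEmbedding.magnus N u) (MagnusEmbedding.magnus N v) : ℝ)
          ≤ 3 * (MagnusEmbedding.wordDist (MagnusEmbedding.quotGens N) u v : ℝ)) ∧
    Function.Injective (MagnusEmbedding.magnus N) 
  := by
  refine ⟨MagnusEmbedding.magnus_bounds N, fun u v => ?_, MagnusEmbedding.magnus_injective N⟩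
  have h := MagnusEmbedding.magnus_bounds N (u⁻¹ * v)
  rw [map_mul, map_inv] at h
  exact h
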